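/- For $n\ge 1$ and $R>0$ let $B_R=\{x\in\mathbb R^n: |x|<R\}$; for $t\in\mathbb R$ let $t_+=[t]_+=\max(t,0)$ and $t_-=[t]_-=\max(-t,0)$, and write $f_-(s)=(f(s))_-$; $u_{x_n}$ is the partial derivative of $u$ with respect to the last coordinate. A positive classical solution of $-\Delta u=f(u)$ in $\overline B_1$ is a function $u\in C^2(B_1)\cap C(\overline B_1)$ with $u>0$ in $\overline B_1$ and $-\Delta u(x)=f(u(x))$ for every $x\in B_1$. **Theorem.** For every $n\ge 1$ and $\sigma\in(0,1)$ there is a constant $C_1>0$, depending only on $n$ and $\sigma$, such that the following holds. Let $f:(0,\infty)\to\mathbb R$ be a $C^2$ function with $f''$ locally Hölder continuous, and let $u$ be a positive classical solution of $-\Delta u=f(u)$ in $\overline B_1$ such that $u_{x_n}>0$ in $B_1$. Then $$\sup_{B_\sigma}\frac{|\nabla u_{x_n}|}{u_{x_n}}\le C_1\biggl\{1+\sup_{B_1}|uf''(u)|^{1/3}\Bigl(1+\sup_{B_1}\Bigl([f'(u)]_++\frac{f_-(u)}{u}\Bigr)^{1/6}\Bigr)+\sup_{B_1}[f'(u)]_-^{1/2}\biggr\}.$$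 In particular, for every $n\ge1$, $\sigma\in(0,1)$ and $p>1$ there is a constant $C_2>0$, depending only on $n,\sigma,p$, such that every positive classical solution $u$ of $-\Delta u=u^p$ in $\overline B_1$ with $u_{x_n}>0$ in $B_1$ satisfies $$\sup_{B_\sigma}\frac{|\nabla u_{x_n}|}{u_{x_n}}\le C_2\Bigl(1+\sup_{B_1}u\Bigr)^{\frac{p-1}{2}}.$$ -/

import Mathlib

open Set Metric Topology Laplacian
open scoped ENNReal NNReal Gradient

/-- `g` is locally Hölder continuous on `U ⊆ ℝ`: near every point of `U` it is Hölder continuous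
with some exponent `α ∈ (0, 1]`. -/
def LocallyHolderOn (g : ℝ → ℝ) (U : Set ℝ) : Prop :=
  ∀ s ∈ U, ∃ α : ℝ≥0, 0 < α ∧ α ≤ 1 ∧ ∃ K : ℝ≥0, ∃ V ∈ 𝓝[U] s, HolderOnWith K α g V

/-- The last coordinate vector `e_n` of `ℝⁿ`, `n ≥ 1`. -/
noncomputable def lastVec (n : ℕ) (hn : 1 ≤ n) : EuclideanSpace ℝ (Fin n) :=
  EuclideanSpace.single ⟨n - 1, Nat.sub_lt hn Nat.one_pos⟩ 1

/-- The partial derivative `u_{x_n}` with respect to the last variable. -/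
noncomputable def partialLast {n : ℕ} (hn : 1 ≤ n) (u : EuclideanSpace ℝ (Fin n) → ℝ) :
    EuclideanSpace ℝ (Fin n) → ℝ :=
  fun x => fderiv ℝ u x (lastVec n hn)

/-- `u` is a positive classical solution of `-Δu = f(u)` in the closed unit ball: it is positive and
continuous on the closed ball, `C²` in the open ball, and satisfies the equation pointwise there.
(If moreover `u` is `C²` up to the boundary, the equation extends to the boundary by
continuity.) -/
structure IsPositiveClassicalSolution {n : ℕ} (f : ℝ → ℝ)
    (u : EuclideanSpace ℝ (Fin n) → ℝ) : Prop where
  continuousOn : ContinuousOn u (closedBall 0 1)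
  contDiffOn : ContDiffOn ℝ 2 u (ball 0 1)
  pos : ∀ x ∈ closedBall (0 : EuclideanSpace ℝ (Fin n)) 1, 0 < u x
  eqn : ∀ x ∈ ball (0 : EuclideanSpace ℝ (Fin n)) 1, -(Δ u x) = f (u x)

/-- The supremum over the ball `B_R` of a nonnegative function `g`, as an element of `[0, ∞]`. -/
noncomputable def supBall {n : ℕ} (R : ℝ) (g : EuclideanSpace ℝ (Fin n) → ℝ) : ℝ≥0∞ :=
  ⨆ x ∈ ball (0 : EuclideanSpace ℝ (Fin n)) R, ENNReal.ofReal (g x)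

/-!
The estimate is Bernstein's gradient bound applied twice.

If `V > 0` and `w = log V`, then `-Δw = h + |∇w|²` with `h = -ΔV / V`. For `P = |∇w|²`, Bochner's
identity and the trace inequality `(Δw)² ≤ n |D²w|²` give
`½ ΔP ≥ (P + h)² / n - ∇w·∇P - ∇h·∇w`. If `h ≥ -N` and `∇h·∇w ≤ N P + N²`, then evaluating this at a
maximum of `(R² - |x - x₀|²)² P` yields `P(x₀) ≤ C(n, R) N` (`bernstein_estimate`).

For `V = u` one has `h = f(u) / u` and `∇h = (f'(u) - f(u) / u) ∇w`, so that `N = 1 + M` is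
admissible when `M` bounds `[f'(u)]₊ + f₋(u) / u`; hence `|∇u| / u ≤ C (1 + M)^{1/2}` on a ball
between `B_σ` and `B_1` (`IsPositiveClassicalSolution.gradSq_le`). For `V = u_{x_n}` one has
`h = f'(u)` and `∇h = f''(u) ∇u`, so that `∇h·∇w ≤ |u f''(u)| (|∇u| / u) P^{1/2}`. By the first step
one may take `N = θ²`, where `θ` is a multiple of the right-hand side of the theorem
(`IsPositiveClassicalSolution.gradSq_pd_le`). The exponents `1/3` and `1/6` come from
Young's inequality `θ³ P^{1/2} ≤ θ² P + θ⁴`, and the exponent `1/2` from `h ≥ -θ²`.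

The argument differentiates `log u_{x_n}` three times, whereas `u` is only `C²`. Instead of proving
more regularity, the estimate is applied to mollifications. Since `f(u)` is `C²`, a mollification `V`
of `u` has both `V` and `-ΔV` close in `C²` to `u` and `f(u)` (`exists_contDiff_approx`), so the
functions `h` and `∇h` of `V` and of its partial derivatives converge uniformly on smaller balls, and
the structural inequalities survive with `2N` in place of `N`
(`gradSq_le_of_isSmoothLimitSolution`).

For `f(s) = s ^ p` both `u f''(u)` and `f'(u)` are multiples of `u ^ (p - 1)` and the negative parts
vanish, so the right-hand side is of order `1 + (sup u) ^ ((p - 1) / 3 + (p - 1) / 6)`.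
-/

/-! ### Partial derivatives and the coordinate Laplacian -/

/-- The partial derivative `∂ᵢ g`. It has the junk value `0` where `g` is not differentiable. -/
noncomputable def pd {n : ℕ} (i : Fin n) (g : EuclideanSpace ℝ (Fin n) → ℝ) :
    EuclideanSpace ℝ (Fin n) → ℝ :=
  fun x => fderiv ℝ g x (EuclideanSpace.single i 1)

/-- The Laplacian in coordinates, `∑ᵢ ∂ᵢ∂ᵢ g`. -/
noncomputable def lap {n : ℕ} (g : EuclideanSpace ℝ (Fin n) → ℝ) :
    EuclideanSpace ℝ (Fin n) → ℝ :=
  fun x => ∑ i, pd i (pd i g) x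

section PartialDerivatives

variable {n : ℕ} {a b g : EuclideanSpace ℝ (Fin n) → ℝ} {x : EuclideanSpace ℝ (Fin n)}

lemma ContDiffAt.pd {m k : WithTop ℕ∞} (hg : ContDiffAt ℝ m g x) (hk : k + 1 ≤ m) (i : Fin n) :
    ContDiffAt ℝ k (pd i g) x :=
  (hg.fderiv_right hk).clm_apply contDiffAt_const

lemma ContDiff.pd {m k : WithTop ℕ∞} (hg : ContDiff ℝ m g) (hk : k + 1 ≤ m) (i : Fin n) :
    ContDiff ℝ k (_root_.pd i g) :=
  contDiff_iff_contDiffAt.2 fun _ => hg.contDiffAt.pd hk i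

lemma Filter.EventuallyEq.pd (h : a =ᶠ[𝓝 x] b) (i : Fin n) : pd i a =ᶠ[𝓝 x] pd i b :=
  (h.fderiv (𝕜 := ℝ)).mono fun _ hy => congrArg (· (EuclideanSpace.single i 1)) hy

lemma pd_add (ha : DifferentiableAt ℝ a x) (hb : DifferentiableAt ℝ b x) (i : Fin n) :
    pd i (fun y => a y + b y) x = pd i a x + pd i b x := by
  simp [pd, fderiv_fun_add ha hb]

lemma pd_neg (i : Fin n) : pd i (fun y => -a y) x = -pd i a x := by
  simp [pd, fderiv_fun_neg]

lemma pd_sum {ι : Type*} {s : Finset ι} {A : ι → EuclideanSpace ℝ (Fin n) → ℝ}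
    (hA : ∀ j ∈ s, DifferentiableAt ℝ (A j) x) (i : Fin n) :
    pd i (fun y => ∑ j ∈ s, A j y) x = ∑ j ∈ s, pd i (A j) x := by
  simp [pd, fderiv_fun_sum hA]

lemma pd_mul (ha : DifferentiableAt ℝ a x) (hb : DifferentiableAt ℝ b x) (i : Fin n) :
    pd i (fun y => a y * b y) x = a x * pd i b x + b x * pd i a x := by
  simp [pd, fderiv_fun_mul ha hb]

lemma pd_comp {φ : ℝ → ℝ} {φ' : ℝ} (hφ : HasDerivAt φ φ' (g x)) (hg : DifferentiableAt ℝ g x)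
    (i : Fin n) : pd i (fun y => φ (g y)) x = φ' * pd i g x := by
  have := (hφ.comp_hasFDerivAt x hg.hasFDerivAt).fderiv
  simp only [pd]
  rw [show (fun y => φ (g y)) = φ ∘ g from rfl, this]
  simp

lemma pd_div (ha : DifferentiableAt ℝ a x) (hb : DifferentiableAt ℝ b x) (h0 : b x ≠ 0)
    (i : Fin n) :
    pd i (fun y => a y / b y) x = (pd i a x * b x - a x * pd i b x) / b x ^ 2 := by
  have hinv : DifferentiableAt ℝ (fun y => (b y)⁻¹) x := hb.inv h0
  simp only [div_eq_mul_inv]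
  rw [pd_mul ha hinv, pd_comp (hasDerivAt_inv h0) hb i]
  field_simp
  ring

lemma pd_pd_eq (hg : ContDiffAt ℝ 2 g x) (i j : Fin n) :
    pd i (pd j g) x
      = fderiv ℝ (fderiv ℝ g) x (EuclideanSpace.single i 1) (EuclideanSpace.single j 1) := by
  have hd : DifferentiableAt ℝ (fderiv ℝ g) x :=
    (hg.fderiv_right (m := 1) (by norm_num)).differentiableAt (by norm_num)
  change fderiv ℝ (fun y => fderiv ℝ g y (EuclideanSpace.single j 1)) x _ = _
  rw [fderiv_clm_apply hd (differentiableAt_const _)]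
  simp

lemma pd_comm (hg : ContDiffAt ℝ 2 g x) (i j : Fin n) : pd i (pd j g) x = pd j (pd i g) x := by
  rw [pd_pd_eq hg, pd_pd_eq hg]
  exact hg.isSymmSndFDerivAt (by simp) _ _

lemma pd_comm_nhds (hg : ContDiffAt ℝ 2 g x) (i j : Fin n) :
    pd i (pd j g) =ᶠ[𝓝 x] pd j (pd i g) :=
  (hg.eventually (by simp)).mono fun _ hy => pd_comm hy i j

lemma lap_pd (hg : ContDiffAt ℝ 3 g x) (j : Fin n) : lap (pd j g) x = pd j (lap g) x := by
  have h2 : ContDiffAt ℝ 2 g x := hg.of_le (by norm_num)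
  unfold lap
  rw [pd_sum]
  · refine Finset.sum_congr rfl fun i _ => ?_
    rw [((pd_comm_nhds h2 i j).pd i).self_of_nhds, pd_comm (hg.pd (by norm_num) i)]
  · intro i _
    exact ((hg.pd (k := 2) (by norm_num) i).pd (k := 1) (by norm_num) i).differentiableAt
      (by norm_num)

lemma lap_mul (ha : ContDiffAt ℝ 2 a x) (hb : ContDiffAt ℝ 2 b x) :
    lap (fun y => a y * b y) x
      = a x * lap b x + 2 * ∑ i, pd i a x * pd i b x + b x * lap a x := by
  have key : ∀ i, pd i (pd i (fun y => a y * b y)) x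
      = a x * pd i (pd i b) x + 2 * (pd i a x * pd i b x) + b x * pd i (pd i a) x := by
    intro i
    have h1 : pd i (fun y => a y * b y) =ᶠ[𝓝 x] fun y => a y * pd i b y + b y * pd i a y := by
      filter_upwards [ha.eventually (by simp), hb.eventually (by simp)] with y h1 h2
      exact pd_mul (h1.differentiableAt (by norm_num)) (h2.differentiableAt (by norm_num)) i
    have da := ha.differentiableAt (by norm_num)
    have db := hb.differentiableAt (by norm_num)
    have da' := (ha.pd (k := 1) (by norm_num) i).differentiableAt (by norm_num)
    have db' := (hb.pd (k := 1) (by norm_num) i).differentiableAt (by norm_num)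
    rw [(h1.pd i).self_of_nhds, pd_add (a := fun y => a y * pd i b y) (b := fun y => b y * pd i a y)
      (da.mul db') (db.mul da'), pd_mul da db', pd_mul db da']
    ring
  simp only [lap, key, Finset.sum_add_distrib, Finset.mul_sum]

lemma pd_coord (i j : Fin n) : pd i (fun y => y j) x = if j = i then 1 else 0 := by
  have : fderiv ℝ (fun y : EuclideanSpace ℝ (Fin n) => y j) x = EuclideanSpace.proj j :=
    (EuclideanSpace.proj (𝕜 := ℝ) j).fderiv
  simp [pd, this]

/-- The necessary second order condition at an interior maximum, in a coordinate direction. -/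
lemma pd_pd_nonpos_of_isLocalMax (hg : ContDiffAt ℝ 2 g x) (hx : IsLocalMax g x) (i : Fin n) :
    pd i (pd i g) x ≤ 0 := by
  set e : EuclideanSpace ℝ (Fin n) := EuclideanSpace.single i 1
  let γ : ℝ → EuclideanSpace ℝ (Fin n) := fun t => x + t • e
  have hγ0 : γ 0 = x := by simp [γ]
  have hγ : ∀ t, HasDerivAt γ e t := fun t => by
    have := ((hasDerivAt_id t).smul_const e).const_add x
    rwa [one_smul] at this
  have hγc : Filter.Tendsto γ (𝓝 0) (𝓝 x) := by
    have := (hγ 0).continuousAt.tendsto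
    rwa [hγ0] at this
  have hline : ∀ {c : EuclideanSpace ℝ (Fin n) → ℝ} {t : ℝ}, DifferentiableAt ℝ c (γ t) →
      HasDerivAt (fun t => c (γ t)) (pd i c (γ t)) t := fun {c t} hc =>
    hc.hasFDerivAt.comp_hasDerivAt t (hγ t)
  have hd1 : deriv (fun t => g (γ t)) =ᶠ[𝓝 0] fun t => pd i g (γ t) := by
    filter_upwards [hγc.eventually (hg.eventually (by simp))] with t ht
    exact (hline (ht.differentiableAt (by norm_num))).deriv
  have hd2 : deriv (deriv fun t => g (γ t)) 0 = pd i (pd i g) x := by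
    rw [hd1.deriv_eq, (hline (t := 0) (c := pd i g) _).deriv, hγ0]
    rw [hγ0]
    exact (hg.pd (k := 1) (by norm_num) i).differentiableAt (by norm_num)
  have hmax : IsLocalMax (fun t => g (γ t)) 0 := by
    filter_upwards [hγc.eventually hx] with t ht
    simpa [hγ0] using ht
  by_contra! hpos
  -- A positive second derivative makes `0` a local minimum too, so `g` is constant along the line.
  have hmin : IsLocalMin (fun t => g (γ t)) 0 := by
    refine isLocalMin_of_deriv_deriv_pos (by rw [hd2]; exact hpos) hmax.deriv_eq_zero ?_
    refine (hline (t := 0) ?_).continuousAt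
    rw [hγ0]
    exact hg.differentiableAt (by norm_num)
  have hconst : (fun t => g (γ t)) =ᶠ[𝓝 0] fun _ => g (γ 0) := by
    filter_upwards [hmax, hmin] with t h1 h2 using le_antisymm h1 h2
  have h0 : deriv (deriv fun t => g (γ t)) 0 = 0 := by
    rw [hconst.deriv.deriv_eq]; simp
  rw [hd2] at h0
  exact hpos.ne' h0

lemma laplacian_eq_lap (hg : ContDiffAt ℝ 2 g x) : (Δ g) x = lap g x := by
  rw [InnerProductSpace.laplacian_eq_iteratedFDeriv_orthonormalBasis g
    (EuclideanSpace.basisFun (Fin n) ℝ)]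
  refine Finset.sum_congr rfl fun i _ => ?_
  rw [pd_pd_eq hg, iteratedFDeriv_two_apply]
  simp

lemma norm_gradient_sq (g : EuclideanSpace ℝ (Fin n) → ℝ) (x : EuclideanSpace ℝ (Fin n)) :
    ‖∇ g x‖ ^ 2 = ∑ i, pd i g x ^ 2 := by
  rw [EuclideanSpace.real_norm_sq_eq]
  refine Finset.sum_congr rfl fun i _ => ?_
  have h : inner ℝ (∇ g x) (EuclideanSpace.single i 1) = fderiv ℝ g x (EuclideanSpace.single i 1) :=
    InnerProductSpace.toDual_symm_apply
  rw [EuclideanSpace.inner_single_right] at h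
  rw [pd, ← h]
  simp

end PartialDerivatives

/-! ### Bernstein's estimate for smooth logarithms -/

/-- The squared length `|∇w|²` of the gradient, in coordinates. -/
noncomputable def gradSq {n : ℕ} (w : EuclideanSpace ℝ (Fin n) → ℝ) :
    EuclideanSpace ℝ (Fin n) → ℝ :=
  fun x => ∑ j, pd j w x ^ 2

/-- The function `h` for which `-Δw = h + |∇w|²`. When `w = log V`, this is `-ΔV / V`. -/
noncomputable def riccatiPotential {n : ℕ} (w : EuclideanSpace ℝ (Fin n) → ℝ) :
    EuclideanSpace ℝ (Fin n) → ℝ :=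
  fun x => -lap w x - gradSq w x

section Bernstein

variable {n : ℕ} {w : EuclideanSpace ℝ (Fin n) → ℝ} {x x₀ : EuclideanSpace ℝ (Fin n)}

lemma gradSq_nonneg (w : EuclideanSpace ℝ (Fin n) → ℝ) (x : EuclideanSpace ℝ (Fin n)) :
    0 ≤ gradSq w x :=
  Finset.sum_nonneg fun _ _ => sq_nonneg _

lemma ContDiffAt.gradSq (hw : ContDiffAt ℝ 3 w x) : ContDiffAt ℝ 2 (gradSq w) x :=
  ContDiffAt.sum fun j _ => (hw.pd (by norm_num) j).pow 2

lemma ContDiffAt.lap (hw : ContDiffAt ℝ 3 w x) : ContDiffAt ℝ 1 (lap w) x :=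
  ContDiffAt.sum fun j _ => (hw.pd (k := 2) (by norm_num) j).pd (by norm_num) j

lemma lap_sum {ι : Type*} {s : Finset ι} {A : ι → EuclideanSpace ℝ (Fin n) → ℝ}
    (hA : ∀ j ∈ s, ContDiffAt ℝ 2 (A j) x) :
    _root_.lap (fun y => ∑ j ∈ s, A j y) x = ∑ j ∈ s, _root_.lap (A j) x := by
  unfold _root_.lap
  rw [Finset.sum_comm]
  refine Finset.sum_congr rfl fun i _ => ?_
  have h1 : pd i (fun y => ∑ j ∈ s, A j y) =ᶠ[𝓝 x] fun y => ∑ j ∈ s, pd i (A j) y := by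
    filter_upwards [(Filter.eventually_all_finset s).2
      fun j hj => (hA j hj).eventually (by simp)] with y hy
    exact pd_sum (fun j hj => (hy j hj).differentiableAt (by norm_num)) i
  rw [(h1.pd i).self_of_nhds, pd_sum]
  exact fun j hj => ((hA j hj).pd (k := 1) (by norm_num) i).differentiableAt (by norm_num)

/-- Bochner's identity in flat space. -/
lemma lap_gradSq (hw : ContDiffAt ℝ 3 w x) :
    lap (gradSq w) x = 2 * ∑ j, ∑ i, pd i (pd j w) x ^ 2
      + 2 * ∑ j, pd j w x * pd j (lap w) x := by
  have h2 : ∀ j, ContDiffAt ℝ 2 (pd j w) x := fun j => hw.pd (by norm_num) j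
  have h1 : gradSq w = fun y => ∑ j, pd j w y * pd j w y := by
    funext y; simp only [gradSq, sq]
  rw [h1, lap_sum fun j _ => (h2 j).mul (h2 j)]
  rw [Finset.mul_sum, Finset.mul_sum, ← Finset.sum_add_distrib]
  refine Finset.sum_congr rfl fun j _ => ?_
  rw [lap_mul (h2 j) (h2 j), lap_pd hw]
  simp only [sq]
  ring

lemma contDiff_sub_norm_sq (R : ℝ) (x₀ : EuclideanSpace ℝ (Fin n)) :
    ContDiff ℝ 2 fun y => R ^ 2 - ‖y - x₀‖ ^ 2 :=
  contDiff_const.sub ((contDiff_id.sub contDiff_const).norm_sq ℝ)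

lemma pd_sub_norm_sq (R : ℝ) (x₀ : EuclideanSpace ℝ (Fin n)) (i : Fin n) :
    pd i (fun y => R ^ 2 - ‖y - x₀‖ ^ 2) = fun y => -2 * (y i - x₀ i) := by
  funext y
  have h := ((((hasFDerivAt_id (𝕜 := ℝ) y).sub_const x₀).norm_sq).const_sub (R ^ 2)).fderiv
  simp only [id] at h
  rw [pd, h]
  simp [EuclideanSpace.inner_single_right]

lemma lap_sub_norm_sq (R : ℝ) (x₀ y : EuclideanSpace ℝ (Fin n)) :
    lap (fun y => R ^ 2 - ‖y - x₀‖ ^ 2) y = -2 * n := by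
  have h : ∀ i, pd i (fun y : EuclideanSpace ℝ (Fin n) => -2 * (y i - x₀ i)) y = -2 := by
    intro i
    have hc : DifferentiableAt ℝ (fun y : EuclideanSpace ℝ (Fin n) => y i) y :=
      (EuclideanSpace.proj (𝕜 := ℝ) i).differentiableAt
    have := pd_comp (φ := fun t => -2 * (t - x₀ i)) (φ' := -2)
      (by simpa using ((hasDerivAt_id (y i)).sub_const (x₀ i)).const_mul (-2)) hc i
    rw [this, pd_coord]
    simp
  simp only [lap, pd_sub_norm_sq, h, Finset.sum_const, Finset.card_univ, Fintype.card_fin,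
    nsmul_eq_mul]
  ring

/-- The pointwise inequality behind Bernstein's estimate, at an interior maximum point of `s² P`
with `P = |∇w|²`. The numbers `p j`, `P' j`, `h' j`, `s' j` stand for the partial derivatives of
`w`, `P`, `h` and `s`, and `H` for `|D²w|²`. -/
lemma bernstein_at_max (hn : 1 ≤ n) {R N s P h H : ℝ} {p P' h' s' : Fin n → ℝ}
    (hR1 : R ≤ 1) (hR : 0 < R) (hN : 1 ≤ N) (hs : 0 < s) (hsR : s ≤ R ^ 2)
    (hP : P = ∑ j, p j ^ 2) (hD : ∑ j, s' j ^ 2 ≤ 4 * R ^ 2)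
    (hh : -N ≤ h) (hg : ∑ j, h' j * p j ≤ N * P + N ^ 2)
    (hH : (h + P) ^ 2 ≤ n * H)
    (hgrad : ∀ j, s * P' j = -2 * P * s' j)
    (hlap : s * s * (2 * H + 2 * ∑ j, p j * (-h' j - P' j))
        + 2 * ∑ j, (2 * s * s' j) * P' j
        + P * (2 * s * (-2 * n) + 2 * ∑ j, s' j ^ 2) ≤ 0) :
    s * s * P ≤ 384 * n ^ 2 * N := by
  have hn' : (1 : ℝ) ≤ n := by exact_mod_cast hn
  have hR2 : R ^ 2 ≤ 1 := by nlinarith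
  have hs1 : s ≤ 1 := hsR.trans hR2
  have hn2 : (1 : ℝ) ≤ n ^ 2 := one_le_pow₀ hn'
  set D := ∑ j, s' j ^ 2 with hDdef
  have hD0 : 0 ≤ D := Finset.sum_nonneg fun _ _ => sq_nonneg _
  have hP0 : 0 ≤ P := by rw [hP]; exact Finset.sum_nonneg fun _ _ => sq_nonneg _
  by_cases hPN : P ≤ 2 * N
  · calc s * s * P ≤ 1 * (2 * N) := by gcongr; nlinarith
      _ ≤ 384 * n ^ 2 * N := by nlinarith
  push Not at hPN
  have hPpos : 0 < P := by linarith
  have e1 : ∑ j, p j * (-h' j - P' j) = -(∑ j, h' j * p j) - ∑ j, p j * P' j := by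
    rw [← Finset.sum_neg_distrib, ← Finset.sum_sub_distrib]
    exact Finset.sum_congr rfl fun j _ => by ring
  have e2 : ∑ j, (2 * s * s' j) * P' j = -4 * P * D := by
    rw [hDdef, Finset.mul_sum]
    exact Finset.sum_congr rfl fun j _ => by linear_combination 2 * s' j * hgrad j
  -- Young's inequality, with the factor `8 n` chosen so that the result is absorbed by `P² / 4n`.
  have e3 : s * s * ∑ j, p j * P' j ≤ P * (s ^ 2 * P / (8 * n) + 8 * n * D) := by
    rw [hDdef]
    nth_rewrite 2 [hP]
    rw [Finset.mul_sum, Finset.mul_sum, Finset.mul_sum, Finset.sum_div, ← Finset.sum_add_distrib,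
      Finset.mul_sum]
    refine Finset.sum_le_sum fun j _ => ?_
    have : s * s * (p j * P' j) = P * (-2 * s * p j * s' j) := by
      linear_combination s * p j * hgrad j
    rw [this]
    refine mul_le_mul_of_nonneg_left ?_ hP0
    have : s ^ 2 * p j ^ 2 / (8 * n) + 8 * n * s' j ^ 2 - -2 * s * p j * s' j
        = (s * p j + 8 * n * s' j) ^ 2 / (8 * n) := by
      field_simp
      ring
    have : 0 ≤ (s * p j + 8 * n * s' j) ^ 2 / (8 * n) := by positivity
    linarith
  have e4 : P ^ 2 / (4 * n) ≤ H := by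
    rw [div_le_iff₀ (by positivity)]
    nlinarith
  rw [e1, e2] at hlap
  have e5 : s * s * (P ^ 2 / (4 * n) - N * P - N ^ 2)
      - P * (s ^ 2 * P / (8 * n) + 8 * n * D) - 4 * P * D
      + P * (s * (-2 * n) + D) ≤ 0 := by
    have : s * s * (P ^ 2 / (4 * n) - N * P - N ^ 2) ≤ s * s * (H - ∑ j, h' j * p j) := by
      exact mul_le_mul_of_nonneg_left (by linarith) (by positivity)
    linarith
  have e6 : s * s * N ^ 2 ≤ P * (s * s * (N / 2)) := by
    have : N ^ 2 ≤ P * (N / 2) := by nlinarith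
    have := mul_le_mul_of_nonneg_left this (mul_pos hs hs).le
    linarith
  have e7 : P * (s * s * P / (8 * n) - (s * s * (3 / 2 * N) + 8 * n * D + 3 * D + 2 * n * s)) ≤ 0 := by
    have : P * (s * s * P / (8 * n)) = s * s * (P ^ 2 / (4 * n)) - P * (s ^ 2 * P / (8 * n)) := by
      field_simp
      ring
    linarith
  have e8 : s * s * P / (8 * n) ≤ s * s * (3 / 2 * N) + 8 * n * D + 3 * D + 2 * n * s := by
    by_contra! hc
    have := mul_pos hPpos (sub_pos.2 hc)
    linarith
  have e9 : s * s * (3 / 2 * N) + 8 * n * D + 3 * D + 2 * n * s ≤ 48 * n * N := by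
    have h1 : s * s * (3 / 2 * N) ≤ 1 * (3 / 2 * N) :=
      mul_le_mul_of_nonneg_right (by nlinarith) (by positivity)
    have h2 : n * D ≤ n * 4 := mul_le_mul_of_nonneg_left (by linarith) (by positivity)
    have h3 : n * s ≤ n * 1 := mul_le_mul_of_nonneg_left hs1 (by positivity)
    have h4 : (n : ℝ) ≤ n * N := le_mul_of_one_le_right (by positivity) hN
    have h5 : N ≤ n * N := le_mul_of_one_le_left (by positivity) hn'
    linarith
  have e10 := e8.trans e9
  rw [div_le_iff₀ (by positivity)] at e10
  linarith

/-- **Bernstein's gradient estimate** for `-Δw = h + |∇w|²`. The potential `h` is bounded below by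
`-N`, and its derivative along `∇w` is controlled by `N|∇w|² + N²`, so that both terms are of lower
order than the `|∇w|⁴` produced by Bochner's identity when `|∇w|²` is large compared to `N`. -/
theorem bernstein_estimate (hn : 1 ≤ n) {R N : ℝ} (hR : 0 < R) (hR1 : R ≤ 1) (hN : 1 ≤ N)
    (hw : ∀ x ∈ closedBall x₀ R, ContDiffAt ℝ 3 w x)
    (hh : ∀ x ∈ ball x₀ R, -N ≤ riccatiPotential w x)
    (hg : ∀ x ∈ ball x₀ R,
      ∑ j, pd j (riccatiPotential w) x * pd j w x ≤ N * gradSq w x + N ^ 2) :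
    R ^ 4 * gradSq w x₀ ≤ 384 * n ^ 2 * N := by
  set s : EuclideanSpace ℝ (Fin n) → ℝ := fun y => R ^ 2 - ‖y - x₀‖ ^ 2 with hs
  have hsC : ∀ y, ContDiffAt ℝ 2 s y := fun y => (contDiff_sub_norm_sq R x₀).contDiffAt
  have hcont : ContinuousOn (fun y => (s y * s y) * gradSq w y) (closedBall x₀ R) := fun y hy =>
    (((hsC y).mul (hsC y)).continuousAt.mul (hw y hy).gradSq.continuousAt).continuousWithinAt
  obtain ⟨x, hx, hmax⟩ := (isCompact_closedBall x₀ R).exists_isMaxOn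
    ⟨x₀, mem_closedBall_self hR.le⟩ hcont
  have hx₀ : R ^ 4 * gradSq w x₀ ≤ (s x * s x) * gradSq w x := by
    have := hmax (mem_closedBall_self hR.le)
    refine le_trans (le_of_eq ?_) this
    simp only [hs, sub_self, norm_zero]
    ring
  refine hx₀.trans ?_
  rw [mem_closedBall, dist_eq_norm] at hx
  rcases hx.eq_or_lt with hx' | hx'
  · have : s x = 0 := by simp [hs, hx']
    rw [this]
    simp only [zero_mul]
    positivity
  have hxb : x ∈ ball x₀ R := by rwa [mem_ball, dist_eq_norm]
  have hwx := hw x (ball_subset_closedBall hxb)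
  have hlm : IsLocalMax (fun y => (s y * s y) * gradSq w y) x :=
    hmax.isLocalMax (Filter.mem_of_superset (isOpen_ball.mem_nhds hxb) ball_subset_closedBall)
  have hspos : 0 < s x := by
    have := norm_nonneg (x - x₀)
    simp only [hs]; nlinarith
  have hPC := hwx.gradSq
  have hPd := hPC.differentiableAt (by norm_num)
  have hsd := (hsC x).differentiableAt (by norm_num)
  have hη : ∀ i, pd i (fun y => s y * s y) x = 2 * s x * pd i s x := fun i => by
    rw [pd_mul hsd hsd]; ring
  refine bernstein_at_max (h := riccatiPotential w x) (H := ∑ j, ∑ i, pd i (pd j w) x ^ 2)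
    (p := fun j => pd j w x) (P' := fun j => pd j (gradSq w) x)
    (h' := fun j => pd j (riccatiPotential w) x) (s' := fun j => pd j s x)
    hn hR1 hR hN hspos ?_ rfl ?_ (hh x hxb) (hg x hxb) ?_ ?_ ?_
  · simp [hs]
  · simp only [hs, pd_sub_norm_sq]
    have : ∑ j, (-2 * (x j - x₀ j)) ^ 2 = 4 * ‖x - x₀‖ ^ 2 := by
      rw [EuclideanSpace.real_norm_sq_eq, Finset.mul_sum]
      exact Finset.sum_congr rfl fun j _ => by simp; ring
    rw [this]
    gcongr
  · -- The trace inequality `(Δw)² ≤ n |D²w|²`.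
    have h1 : riccatiPotential w x + gradSq w x = -lap w x := by simp [riccatiPotential]
    rw [h1, neg_sq]
    calc lap w x ^ 2 ≤ n * ∑ j, pd j (pd j w) x ^ 2 := by
          simpa [lap] using sq_sum_le_card_mul_sum_sq (s := Finset.univ) (f := fun j => pd j (pd j w) x)
      _ ≤ n * ∑ j, ∑ i, pd i (pd j w) x ^ 2 := by
          gcongr with j
          exact Finset.single_le_sum (f := fun i => pd i (pd j w) x ^ 2)
            (fun _ _ => sq_nonneg _) (Finset.mem_univ j)
  · intro j
    have h0 : pd j (fun y => (s y * s y) * gradSq w y) x = 0 := by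
      simp [pd, hlm.fderiv_eq_zero]
    rw [pd_mul (a := fun y => s y * s y) (hsd.mul hsd) hPd, hη] at h0
    exact mul_left_cancel₀ hspos.ne' (by linear_combination h0)
  · have h0 : lap (fun y => (s y * s y) * gradSq w y) x ≤ 0 :=
      Finset.sum_nonpos fun i _ =>
        pd_pd_nonpos_of_isLocalMax (((hsC x).mul (hsC x)).mul hPC) hlm i
    rw [lap_mul (a := fun y => s y * s y) ((hsC x).mul (hsC x)) hPC, lap_gradSq hwx, lap_mul (hsC x) (hsC x),
      lap_sub_norm_sq] at h0
    have h1 : ∀ j, pd j (lap w) x = -pd j (riccatiPotential w) x - pd j (gradSq w) x := by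
      intro j
      have hl := hwx.lap.differentiableAt (by norm_num)
      have : riccatiPotential w = fun y => -lap w y + -gradSq w y := by
        funext y; simp only [riccatiPotential]; ring
      rw [this, pd_add hl.fun_neg hPd.fun_neg, pd_neg, pd_neg]
      ring
    simp only [h1, hη] at h0
    refine le_trans (le_of_eq ?_) h0
    simp only [sq]
    ring

end Bernstein

/-! ### Mollification up to second order -/

section Mollification

open MeasureTheory

variable {n : ℕ} {x : EuclideanSpace ℝ (Fin n)} {F F' : EuclideanSpace ℝ (Fin n) → ℝ}

/-- The convolution of `F` with a normalized bump function. -/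
noncomputable def mollify {n : ℕ} (φ : ContDiffBump (0 : EuclideanSpace ℝ (Fin n)))
    (F : EuclideanSpace ℝ (Fin n) → ℝ) : EuclideanSpace ℝ (Fin n) → ℝ :=
  convolution (φ.normed volume) F (ContinuousLinearMap.lsmul ℝ ℝ) volume

/-- The derivatives of order at most two of `a` and `b` at `x` differ by less than `ε`. -/
def C2Close {n : ℕ} (ε : ℝ) (a b : EuclideanSpace ℝ (Fin n) → ℝ)
    (x : EuclideanSpace ℝ (Fin n)) : Prop :=
  |a x - b x| < ε ∧ (∀ j, |pd j a x - pd j b x| < ε) ∧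
    ∀ i j, |pd i (pd j a) x - pd i (pd j b) x| < ε

lemma C2Close.congr {ε : ℝ} {a b a' b' : EuclideanSpace ℝ (Fin n) → ℝ} (h : C2Close ε a b x)
    (ha : a =ᶠ[𝓝 x] a') (hb : b =ᶠ[𝓝 x] b') : C2Close ε a' b' x := by
  obtain ⟨h0, h1, h2⟩ := h
  refine ⟨?_, fun j => ?_, fun i j => ?_⟩
  · rw [← ha.self_of_nhds, ← hb.self_of_nhds]; exact h0
  · rw [← (ha.pd j).self_of_nhds, ← (hb.pd j).self_of_nhds]; exact h1 j
  · rw [← ((ha.pd j).pd i).self_of_nhds, ← ((hb.pd j).pd i).self_of_nhds]; exact h2 i j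

lemma HasCompactSupport.pd (hF : HasCompactSupport F) (i : Fin n) : HasCompactSupport (pd i F) :=
  (hF.fderiv ℝ).mono' ((Function.support_subset_iff'.2 fun y hy => by
    simp only [_root_.pd, Function.notMem_support.1 hy, zero_apply]).trans
      (subset_tsupport _))

lemma contDiff_mollify (φ : ContDiffBump (0 : EuclideanSpace ℝ (Fin n))) (hF : Continuous F) :
    ContDiff ℝ (⊤ : ℕ∞) (mollify φ F) :=
  φ.hasCompactSupport_normed.contDiff_convolution_left _ φ.contDiff_normed hF.locallyIntegrable

lemma pd_mollify (φ : ContDiffBump (0 : EuclideanSpace ℝ (Fin n))) (hF : ContDiff ℝ 1 F)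
    (hc : HasCompactSupport F) (i : Fin n) : pd i (mollify φ F) = mollify φ (pd i F) := by
  funext x
  have h := (hc.hasFDerivAt_convolution_right (ContinuousLinearMap.lsmul ℝ ℝ)
    (μ := volume) (φ.continuous_normed (μ := volume)).locallyIntegrable hF x).fderiv
  have hint : ConvolutionExistsAt (φ.normed volume) (fderiv ℝ F) x
      ((ContinuousLinearMap.lsmul ℝ ℝ : ℝ →L[ℝ] ℝ →L[ℝ] ℝ).precompR
        (EuclideanSpace ℝ (Fin n))) volume :=
    (hc.fderiv ℝ).convolutionExists_right _ (φ.continuous_normed (μ := volume)).locallyIntegrable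
      (hF.continuous_fderiv (by norm_num)) x
  rw [pd, mollify, h, mollify, convolution, ContinuousLinearMap.integral_apply hint]
  rfl

lemma mollify_congr (φ : ContDiffBump (0 : EuclideanSpace ℝ (Fin n)))
    (h : ∀ y ∈ ball x φ.rOut, F y = F' y) : mollify φ F x = mollify φ F' x := by
  simp only [mollify, convolution]
  refine integral_congr_ae (Filter.Eventually.of_forall fun t => ?_)
  by_cases ht : t ∈ ball (0 : EuclideanSpace ℝ (Fin n)) φ.rOut
  · have : F (x - t) = F' (x - t) := h _ (by simpa [dist_eq_norm] using ht)
    simp only [this]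
  · have : φ.normed volume t = 0 := by
      rw [← Function.notMem_support, φ.support_normed_eq]; exact ht
    simp [this]

lemma mollify_neg (φ : ContDiffBump (0 : EuclideanSpace ℝ (Fin n))) :
    mollify φ (fun y => -F y) x = -mollify φ F x := by
  simp only [mollify, convolution, map_neg, integral_neg]

lemma mollify_sum (φ : ContDiffBump (0 : EuclideanSpace ℝ (Fin n))) {ι : Type*} {s : Finset ι}
    {A : ι → EuclideanSpace ℝ (Fin n) → ℝ} (hA : ∀ i ∈ s, Continuous (A i)) :
    mollify φ (fun y => ∑ i ∈ s, A i y) x = ∑ i ∈ s, mollify φ (A i) x := by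
  simp only [mollify, convolution, map_sum]
  refine integral_finsetSum _ fun i hi => ?_
  exact φ.hasCompactSupport_normed.convolutionExists_left (ContinuousLinearMap.lsmul ℝ ℝ)
    φ.continuous_normed (hA i hi).locallyIntegrable x

lemma lap_mollify (φ : ContDiffBump (0 : EuclideanSpace ℝ (Fin n))) (hF : ContDiff ℝ 2 F)
    (hc : HasCompactSupport F) : lap (mollify φ F) x = mollify φ (lap F) x := by
  unfold lap
  rw [mollify_sum]
  · refine Finset.sum_congr rfl fun i _ => ?_
    rw [pd_mollify φ (hF.of_le (by norm_num)) hc,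
      pd_mollify φ (hF.pd (by norm_num) i) (hc.pd i)]
  · exact fun i _ => ((hF.pd (k := 1) (by norm_num) i).pd (k := 0) (by norm_num) i).continuous

lemma exists_mollify_close (hF : Continuous F) (hc : HasCompactSupport F) {ε : ℝ} (hε : 0 < ε) :
    ∃ δ > 0, ∀ φ : ContDiffBump (0 : EuclideanSpace ℝ (Fin n)), φ.rOut < δ →
      ∀ x, |mollify φ F x - F x| < ε := by
  obtain ⟨δ, hδ, h⟩ := Metric.uniformContinuous_iff.1
    (hc.uniformContinuous_of_continuous hF) (ε / 2) (by positivity)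
  refine ⟨δ, hδ, fun φ hφ x => ?_⟩
  have := φ.dist_normed_convolution_le (μ := volume) (x₀ := x) (ε := ε / 2)
    hF.aestronglyMeasurable fun y hy => (h ((mem_ball.1 hy).trans hφ)).le
  rw [Real.dist_eq] at this
  exact this.trans_lt (by linarith)

lemma exists_mollify_C2Close (hF : ContDiff ℝ 2 F) (hc : HasCompactSupport F) {ε : ℝ}
    (hε : 0 < ε) :
    ∃ δ > 0, ∀ φ : ContDiffBump (0 : EuclideanSpace ℝ (Fin n)), φ.rOut < δ →
      ∀ x, C2Close ε (mollify φ F) F x := by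
  have hF1 : ∀ j, ContDiff ℝ 1 (pd j F) := hF.pd (by norm_num)
  have hF2 : ∀ i j, Continuous (pd i (pd j F)) := fun i j =>
    ((hF1 j).pd (k := 0) (by norm_num) i).continuous
  obtain ⟨d0, hd0, h0⟩ := exists_mollify_close hF.continuous hc hε
  choose d1 hd1 h1 using fun j => exists_mollify_close (hF1 j).continuous (hc.pd j) hε
  choose d2 hd2 h2 using fun i j => exists_mollify_close (hF2 i j) ((hc.pd j).pd i) hε
  have hfin : ∃ δ > 0, δ < d0 ∧ (∀ j, δ < d1 j) ∧ ∀ i j, δ < d2 i j := by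
    have h : ∀ᶠ δ in 𝓝[>] (0 : ℝ), δ < d0 ∧ (∀ j, δ < d1 j) ∧ ∀ i j, δ < d2 i j := by
      have : ∀ {d : ℝ}, 0 < d → ∀ᶠ δ in 𝓝[>] (0 : ℝ), δ < d := fun hd =>
        nhdsWithin_le_nhds (Iio_mem_nhds hd)
      exact (this hd0).and ((Filter.eventually_all.2 fun j => this (hd1 j)).and
        (Filter.eventually_all.2 fun i => Filter.eventually_all.2 fun j => this (hd2 i j)))
    obtain ⟨δ, hδ, hpos⟩ := (h.and self_mem_nhdsWithin).exists
    exact ⟨δ, hpos, hδ⟩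
  obtain ⟨δ, hδ, l0, l1, l2⟩ := hfin
  refine ⟨δ, hδ, fun φ hφ x => ⟨h0 φ (hφ.trans l0) x, fun j => ?_, fun i j => ?_⟩⟩
  · rw [pd_mollify φ (hF.of_le (by norm_num)) hc]
    exact h1 j φ (hφ.trans (l1 j)) x
  · rw [pd_mollify φ (hF.of_le (by norm_num)) hc, pd_mollify φ (hF1 j) (hc.pd j)]
    exact h2 i j φ (hφ.trans (l2 i j)) x

lemma contDiff_bump_mul {x₀ : EuclideanSpace ℝ (Fin n)} (χ : ContDiffBump x₀) {R : ℝ}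
    (hχ : χ.rOut < R) (hF : ContDiffOn ℝ 2 F (ball x₀ R)) :
    ContDiff ℝ 2 (fun y => χ y * F y) := by
  refine contDiff_iff_contDiffAt.2 fun y => ?_
  by_cases hy : y ∈ tsupport fun y => χ y * F y
  swap
  · exact contDiffAt_const.congr_of_eventuallyEq (notMem_tsupport_iff_eventuallyEq.1 hy)
  have hy' : y ∈ closedBall x₀ χ.rOut := by
    rw [← χ.tsupport_eq]; exact tsupport_mul_subset_left hy
  exact χ.contDiff.contDiffAt.mul
    (hF.contDiffAt (isOpen_ball.mem_nhds (closedBall_subset_ball hχ hy')))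

/-- If `-Δu = g` with `u` and `g` both `C²`, then on smaller balls there are smooth `V` such that
`V` is `C²`-close to `u` and simultaneously `-ΔV` is `C²`-close to `g`. Mollification commutes with
the Laplacian, so the second approximation costs no more derivatives of `u`, and this is what makes
elliptic regularity theory unnecessary here. -/
theorem exists_contDiff_approx {u g : EuclideanSpace ℝ (Fin n) → ℝ}
    {x₀ : EuclideanSpace ℝ (Fin n)} {R R' : ℝ} (hR : 0 < R) (hRR' : R < R')
    (hu : ContDiffOn ℝ 2 u (ball x₀ R')) (hg : ContDiffOn ℝ 2 g (ball x₀ R'))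
    (heq : ∀ x ∈ ball x₀ R', -lap u x = g x) {ε : ℝ} (hε : 0 < ε) :
    ∃ V : EuclideanSpace ℝ (Fin n) → ℝ, ContDiff ℝ (⊤ : ℕ∞) V ∧
      ∀ x ∈ closedBall x₀ R, C2Close ε V u x ∧ C2Close ε (fun y => -lap V y) g x := by
  set d := (R' - R) / 4 with hd
  have hdpos : 0 < d := by linarith
  let χ : ContDiffBump x₀ := ⟨R + 2 * d, R + 3 * d, by linarith, by linarith⟩
  have hχ : χ.rOut < R' := by change R + 3 * d < R'; linarith
  have hχ1 : ∀ y ∈ ball x₀ (R + 2 * d), χ y = 1 := fun y hy =>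
    χ.one_of_mem_closedBall (ball_subset_closedBall hy)
  have hcu := contDiff_bump_mul χ hχ hu
  have hcg := contDiff_bump_mul χ hχ hg
  have hsu : HasCompactSupport fun y => χ y * u y := χ.hasCompactSupport.mul_right
  have hsg : HasCompactSupport fun y => χ y * g y := χ.hasCompactSupport.mul_right
  have hnear : ∀ c : EuclideanSpace ℝ (Fin n) → ℝ, ∀ y ∈ ball x₀ (R + 2 * d),
      (fun z => χ z * c z) =ᶠ[𝓝 y] c := fun c y hy => by
    filter_upwards [isOpen_ball.mem_nhds hy] with z hz
    rw [hχ1 z hz, one_mul]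
  obtain ⟨δ₁, hδ₁, h1⟩ := exists_mollify_C2Close hcu hsu hε
  obtain ⟨δ₂, hδ₂, h2⟩ := exists_mollify_C2Close hcg hsg hε
  obtain ⟨δ, hδ, hlt⟩ := exists_between (lt_min (lt_min hδ₁ hδ₂) hdpos)
  obtain ⟨hlt', hltd⟩ := lt_min_iff.1 hlt
  obtain ⟨hlt1, hlt2⟩ := lt_min_iff.1 hlt'
  let φ : ContDiffBump (0 : EuclideanSpace ℝ (Fin n)) :=
    ⟨δ / 2, δ, by linarith, by linarith⟩
  refine ⟨mollify φ fun y => χ y * u y, contDiff_mollify φ hcu.continuous, fun x hx => ?_⟩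
  have hxb : x ∈ ball x₀ (R + 2 * d) := closedBall_subset_ball (by linarith) hx
  refine ⟨(h1 φ hlt1 x).congr Filter.EventuallyEq.rfl (hnear u x hxb),
    (h2 φ hlt2 x).congr ?_ (hnear g x hxb)⟩
  have hxd : x ∈ ball x₀ (R + d) := closedBall_subset_ball (by linarith) hx
  filter_upwards [isOpen_ball.mem_nhds hxd] with y hy
  rw [lap_mollify φ hcu hsu, ← mollify_neg]
  refine mollify_congr φ fun z hz => ?_
  have hzb : z ∈ ball x₀ (R + 2 * d) := by
    have h3 : dist z y < δ := hz
    have h4 : dist y x₀ < R + d := hy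
    have := dist_triangle z y x₀
    rw [mem_ball]; linarith
  have hlap : lap (fun y => χ y * u y) z = lap u z :=
    Finset.sum_congr rfl fun i _ => (((hnear u z hzb).pd i).pd i).self_of_nhds
  rw [hlap, heq z (ball_subset_ball (by linarith) hzb), hχ1 z hzb, one_mul]

end Mollification

/-! ### The estimate for positive functions of low regularity -/

section Limit

variable {n : ℕ} {x x₀ : EuclideanSpace ℝ (Fin n)}

lemma pd_log {V : EuclideanSpace ℝ (Fin n) → ℝ} (hV : DifferentiableAt ℝ V x) (h0 : 0 < V x)
    (j : Fin n) : pd j (fun y => Real.log (V y)) x = pd j V x / V x := by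
  rw [pd_comp (Real.hasDerivAt_log h0.ne') hV]
  ring

lemma gradSq_log {V : EuclideanSpace ℝ (Fin n) → ℝ} (hV : DifferentiableAt ℝ V x)
    (h0 : 0 < V x) : gradSq (fun y => Real.log (V y)) x = gradSq V x / V x ^ 2 := by
  simp only [gradSq, pd_log hV h0, div_pow, Finset.sum_div]

lemma riccatiPotential_log {V : EuclideanSpace ℝ (Fin n) → ℝ} (hV : ContDiff ℝ 2 V)
    (h0 : 0 < V x) : riccatiPotential (fun y => Real.log (V y)) x = -lap V x / V x := by
  have hd : Differentiable ℝ V := hV.differentiable (by norm_num)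
  have key : ∀ i, pd i (pd i fun y => Real.log (V y)) x
      = pd i (pd i V) x / V x - pd i V x ^ 2 / V x ^ 2 := by
    intro i
    have h1 : (pd i fun y => Real.log (V y)) =ᶠ[𝓝 x] fun y => pd i V y / V y := by
      filter_upwards [hV.continuous.continuousAt.eventually (lt_mem_nhds h0)] with y hy
      exact pd_log (hd y) hy i
    rw [(h1.pd i).self_of_nhds, pd_div _ (hd x) h0.ne']
    · field_simp
    · exact (hV.pd (k := 1) (by norm_num) i).differentiable (by norm_num) x
  rw [riccatiPotential, gradSq_log (hd x) h0]
  simp only [lap, key, gradSq, Finset.sum_sub_distrib, ← Finset.sum_div]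
  ring

/-- Bernstein's estimate for the logarithm of a smooth positive function `V`, with the hypotheses
on the potential `-ΔV / V` cleared of denominators. -/
lemma gradSq_le_of_contDiff (hn : 1 ≤ n) {R N : ℝ} (hR : 0 < R) (hR1 : R ≤ 1) (hN : 1 ≤ N)
    {V : EuclideanSpace ℝ (Fin n) → ℝ} (hV : ContDiff ℝ (⊤ : ℕ∞) V)
    (hpos : ∀ x ∈ closedBall x₀ R, 0 < V x)
    (h1 : ∀ x ∈ closedBall x₀ R, -N * V x ≤ -lap V x)
    (h2 : ∀ x ∈ closedBall x₀ R,
      ∑ j, (pd j (fun y => -lap V y) x * V x - -lap V x * pd j V x) * pd j V x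
        ≤ N * V x * gradSq V x + N ^ 2 * V x ^ 3) :
    R ^ 4 * gradSq V x₀ ≤ 384 * n ^ 2 * N * V x₀ ^ 2 := by
  have hV3 : ContDiff ℝ 3 V := contDiff_infty.1 hV 3
  have hV2 : ContDiff ℝ 2 V := hV3.of_le (by norm_num)
  have hd : Differentiable ℝ V := hV2.differentiable (by norm_num)
  have hx₀ := hpos x₀ (mem_closedBall_self hR.le)
  have key := bernstein_estimate (w := fun y => Real.log (V y)) (x₀ := x₀) hn hR hR1 hN
    (fun x hx => hV3.contDiffAt.log (hpos x hx).ne') ?_ ?_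
  · rw [gradSq_log (hd x₀) hx₀, ← mul_div_assoc, div_le_iff₀ (by positivity)] at key
    exact key
  · intro x hx
    have h0 := hpos x (ball_subset_closedBall hx)
    rw [riccatiPotential_log hV2 h0, le_div_iff₀ h0]
    exact h1 x (ball_subset_closedBall hx)
  · intro x hx
    have h0 := hpos x (ball_subset_closedBall hx)
    have hr : riccatiPotential (fun y => Real.log (V y)) =ᶠ[𝓝 x] fun y => -lap V y / V y := by
      filter_upwards [hV2.continuous.continuousAt.eventually (lt_mem_nhds h0)] with y hy
      exact riccatiPotential_log hV2 hy
    have hl : DifferentiableAt ℝ (fun y => -lap V y) x :=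
      (hV3.contDiffAt.lap.differentiableAt (by norm_num)).fun_neg
    have hj : ∀ j, pd j (riccatiPotential fun y => Real.log (V y)) x
        * pd j (fun y => Real.log (V y)) x
        = (pd j (fun y => -lap V y) x * V x - -lap V x * pd j V x) * pd j V x / V x ^ 3 := by
      intro j
      rw [(hr.pd j).self_of_nhds, pd_log (hd x) h0, pd_div hl (hd x) h0.ne']
      field_simp
    simp only [hj, gradSq_log (hd x) h0]
    rw [← Finset.sum_div, div_le_iff₀ (by positivity)]
    refine (h2 x (ball_subset_closedBall hx)).trans (le_of_eq ?_)
    field_simp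

/-- The first order jet of a pair of functions, `(U, ∇U, G, ∇G)`. -/
noncomputable def pairJet {n : ℕ} (U G : EuclideanSpace ℝ (Fin n) → ℝ)
    (x : EuclideanSpace ℝ (Fin n)) : ℝ × (Fin n → ℝ) × ℝ × (Fin n → ℝ) :=
  (U x, fun j => pd j U x, G x, fun j => pd j G x)

/-- `U` solves `-ΔU = G` on `K` as a limit of smooth functions: some smooth `V` have `(V, -ΔV)`
arbitrarily close to `(U, G)`, uniformly on `K` and together with first derivatives. The function
`U` itself need not have second derivatives. -/
def IsSmoothLimitSolution {n : ℕ} (U G : EuclideanSpace ℝ (Fin n) → ℝ)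
    (K : Set (EuclideanSpace ℝ (Fin n))) : Prop :=
  ∀ ε > 0, ∃ V : EuclideanSpace ℝ (Fin n) → ℝ, ContDiff ℝ (⊤ : ℕ∞) V ∧
    ∀ x ∈ K, dist (pairJet V (fun y => -lap V y) x) (pairJet U G x) < ε

/-- The logarithmic gradient estimate for `C¹` limits of smooth functions. The structural
inequalities become strict after doubling `N`, so by compactness they pass to smooth approximants;
the conclusion is closed and passes back. -/
theorem gradSq_le_of_isSmoothLimitSolution (hn : 1 ≤ n) {R N : ℝ} (hR : 0 < R) (hR1 : R ≤ 1)
    (hN : 1 ≤ N) {U G : EuclideanSpace ℝ (Fin n) → ℝ}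
    (hU : IsSmoothLimitSolution U G (closedBall x₀ R))
    (hc : ContinuousOn (pairJet U G) (closedBall x₀ R))
    (hpos : ∀ x ∈ closedBall x₀ R, 0 < U x)
    (h1 : ∀ x ∈ closedBall x₀ R, -N * U x ≤ G x)
    (h2 : ∀ x ∈ closedBall x₀ R,
      ∑ j, (pd j G x * U x - G x * pd j U x) * pd j U x
        ≤ N * U x * gradSq U x + N ^ 2 * U x ^ 3) :
    R ^ 4 * gradSq U x₀ ≤ 768 * n ^ 2 * N * U x₀ ^ 2 := by
  by_contra! hlt
  let O : Set (ℝ × (Fin n → ℝ) × ℝ × (Fin n → ℝ)) :=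
    {y | 0 < y.1} ∩ ({y | -(2 * N) * y.1 < y.2.2.1} ∩
      {y | ∑ j, (y.2.2.2 j * y.1 - y.2.2.1 * y.2.1 j) * y.2.1 j
        < 2 * N * y.1 * (∑ j, y.2.1 j ^ 2) + (2 * N) ^ 2 * y.1 ^ 3})
  let O' : Set (ℝ × (Fin n → ℝ) × ℝ × (Fin n → ℝ)) :=
    {y | 768 * n ^ 2 * N * y.1 ^ 2 < R ^ 4 * ∑ j, y.2.1 j ^ 2}
  have hO : IsOpen O := (isOpen_lt (by fun_prop) (by fun_prop)).inter
    ((isOpen_lt (by fun_prop) (by fun_prop)).inter (isOpen_lt (by fun_prop) (by fun_prop)))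
  have hO' : IsOpen O' := isOpen_lt (by fun_prop) (by fun_prop)
  have hsub : pairJet U G '' closedBall x₀ R ⊆ O := by
    rintro _ ⟨x, hx, rfl⟩
    have h0 := hpos x hx
    refine ⟨h0, ?_, ?_⟩
    · change -(2 * N) * U x < G x
      have := h1 x hx
      nlinarith
    · change ∑ j, (pd j G x * U x - G x * pd j U x) * pd j U x
        < 2 * N * U x * gradSq U x + (2 * N) ^ 2 * U x ^ 3
      have h3 : 0 < N ^ 2 * U x ^ 3 := by positivity
      have h4 : 0 ≤ N * U x * gradSq U x := by have := gradSq_nonneg U x; positivity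
      have := h2 x hx
      linarith
  obtain ⟨δ, hδ, hthick⟩ :=
    ((isCompact_closedBall x₀ R).image_of_continuousOn hc).exists_thickening_subset_open hO hsub
  obtain ⟨δ', hδ', hball⟩ := Metric.isOpen_iff.1 hO' (pairJet U G x₀) hlt
  obtain ⟨V, hV, hclose⟩ := hU (min δ δ') (lt_min hδ hδ')
  have hVO : ∀ x ∈ closedBall x₀ R, pairJet V (fun y => -lap V y) x ∈ O := fun x hx =>
    hthick (mem_thickening_iff.2 ⟨_, ⟨x, hx, rfl⟩, (hclose x hx).trans_le (min_le_left _ _)⟩)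
  have hVO' : pairJet V (fun y => -lap V y) x₀ ∈ O' :=
    hball ((hclose x₀ (mem_closedBall_self hR.le)).trans_le (min_le_right _ _))
  have := gradSq_le_of_contDiff hn hR hR1 (N := 2 * N) (by linarith) hV
    (fun x hx => (hVO x hx).1) (fun x hx => (hVO x hx).2.1.le) (fun x hx => (hVO x hx).2.2.le)
  have h5 : 768 * n ^ 2 * N * V x₀ ^ 2 < R ^ 4 * gradSq V x₀ := hVO'
  linarith

variable {u g : EuclideanSpace ℝ (Fin n) → ℝ} {R R' : ℝ}

lemma isSmoothLimitSolution_of_contDiffOn (hR : 0 < R) (hRR' : R < R')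
    (hu : ContDiffOn ℝ 2 u (ball x₀ R')) (hg : ContDiffOn ℝ 2 g (ball x₀ R'))
    (heq : ∀ x ∈ ball x₀ R', -lap u x = g x) :
    IsSmoothLimitSolution u g (closedBall x₀ R) := by
  intro ε hε
  obtain ⟨V, hV, h⟩ := exists_contDiff_approx hR hRR' hu hg heq hε
  refine ⟨V, hV, fun x hx => ?_⟩
  obtain ⟨⟨a0, a1, -⟩, b0, b1, -⟩ := h x hx
  simp only [pairJet, Prod.dist_eq, max_lt_iff, dist_pi_lt_iff hε, Real.dist_eq]
  exact ⟨a0, a1, b0, b1⟩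

/-- Differentiating the equation: `∂ₖu` is a limit solution with right-hand side `∂ₖg`. -/
lemma isSmoothLimitSolution_pd (hR : 0 < R) (hRR' : R < R')
    (hu : ContDiffOn ℝ 2 u (ball x₀ R')) (hg : ContDiffOn ℝ 2 g (ball x₀ R'))
    (heq : ∀ x ∈ ball x₀ R', -lap u x = g x) (k : Fin n) :
    IsSmoothLimitSolution (pd k u) (pd k g) (closedBall x₀ R) := by
  intro ε hε
  obtain ⟨V, hV, h⟩ := exists_contDiff_approx hR hRR' hu hg heq hε
  have hV3 : ContDiff ℝ 3 V := contDiff_infty.1 hV 3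
  refine ⟨pd k V, hV.pd (by simp) k, fun x hx => ?_⟩
  have hcomm : (fun y => -lap (pd k V) y) = pd k fun y => -lap V y := by
    funext y
    rw [pd_neg, lap_pd hV3.contDiffAt]
  obtain ⟨⟨-, a1, a2⟩, -, b1, b2⟩ := h x hx
  rw [hcomm]
  simp only [pairJet, Prod.dist_eq, max_lt_iff, dist_pi_lt_iff hε, Real.dist_eq]
  exact ⟨a1 k, fun j => a2 j k, b1 k, fun j => b2 j k⟩

lemma continuousAt_pairJet (hu : ContDiffAt ℝ 1 u x) (hg : ContDiffAt ℝ 1 g x) :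
    ContinuousAt (pairJet u g) x := by
  refine hu.continuousAt.prodMk (ContinuousAt.prodMk (continuousAt_pi.2 fun j => ?_)
    (hg.continuousAt.prodMk (continuousAt_pi.2 fun j => ?_)))
  · exact (hu.pd (k := 0) (by norm_num) j).continuousAt
  · exact (hg.pd (k := 0) (by norm_num) j).continuousAt

end Limit

/-! ### Logarithmic gradient estimates for solutions of `-Δu = f(u)` -/

section Solutions

variable {n : ℕ} {f : ℝ → ℝ} {u : EuclideanSpace ℝ (Fin n) → ℝ}
  {x x₀ : EuclideanSpace ℝ (Fin n)} {R R' : ℝ}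

lemma ContDiffOn.deriv_Ioi (hf : ContDiffOn ℝ 2 f (Ioi 0)) :
    ContDiffOn ℝ 1 (deriv f) (Ioi 0) ∧ ContinuousOn (deriv (deriv f)) (Ioi 0) := by
  have h1 : ContDiffOn ℝ 1 (deriv f) (Ioi 0) := hf.deriv_of_isOpen isOpen_Ioi (by norm_num)
  exact ⟨h1, (h1.deriv_of_isOpen (m := 0) isOpen_Ioi (by norm_num)).continuousOn⟩

lemma IsPositiveClassicalSolution.contDiffAt (hu : IsPositiveClassicalSolution f u)
    (hx : x ∈ ball (0 : EuclideanSpace ℝ (Fin n)) 1) : ContDiffAt ℝ 2 u x :=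
  hu.contDiffOn.contDiffAt (isOpen_ball.mem_nhds hx)

lemma IsPositiveClassicalSolution.pos_of_mem_ball (hu : IsPositiveClassicalSolution f u)
    (hx : x ∈ ball (0 : EuclideanSpace ℝ (Fin n)) 1) : 0 < u x :=
  hu.pos x (ball_subset_closedBall hx)

lemma IsPositiveClassicalSolution.contDiffAt_comp (hu : IsPositiveClassicalSolution f u)
    (hf : ContDiffOn ℝ 2 f (Ioi 0)) (hx : x ∈ ball (0 : EuclideanSpace ℝ (Fin n)) 1) :
    ContDiffAt ℝ 2 (fun y => f (u y)) x :=
  (hf.contDiffAt (Ioi_mem_nhds (hu.pos_of_mem_ball hx))).comp x (hu.contDiffAt hx)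

lemma IsPositiveClassicalSolution.neg_lap (hu : IsPositiveClassicalSolution f u)
    (hx : x ∈ ball (0 : EuclideanSpace ℝ (Fin n)) 1) : -lap u x = f (u x) := by
  rw [← laplacian_eq_lap (hu.contDiffAt hx), hu.eqn x hx]

lemma IsPositiveClassicalSolution.pd_comp (hu : IsPositiveClassicalSolution f u)
    (hf : ContDiffOn ℝ 2 f (Ioi 0)) (hx : x ∈ ball (0 : EuclideanSpace ℝ (Fin n)) 1)
    (j : Fin n) : pd j (fun y => f (u y)) x = deriv f (u x) * pd j u x :=
  _root_.pd_comp ((hf.contDiffAt (Ioi_mem_nhds (hu.pos_of_mem_ball hx))).differentiableAt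
    (by norm_num)).hasDerivAt ((hu.contDiffAt hx).differentiableAt (by norm_num)) j

lemma IsPositiveClassicalSolution.pd_pd_comp (hu : IsPositiveClassicalSolution f u)
    (hf : ContDiffOn ℝ 2 f (Ioi 0)) (hx : x ∈ ball (0 : EuclideanSpace ℝ (Fin n)) 1)
    (j k : Fin n) : pd j (pd k fun y => f (u y)) x
      = deriv f (u x) * pd j (pd k u) x + pd k u x * (deriv (deriv f) (u x) * pd j u x) := by
  have h1 : (pd k fun y => f (u y)) =ᶠ[𝓝 x] fun y => deriv f (u y) * pd k u y := by
    filter_upwards [isOpen_ball.mem_nhds hx] with y hy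
    exact hu.pd_comp hf hy k
  have hd : DifferentiableAt ℝ u x := (hu.contDiffAt hx).differentiableAt (by norm_num)
  have hf' : DifferentiableAt ℝ (deriv f) (u x) :=
    (hf.deriv_Ioi.1.contDiffAt (Ioi_mem_nhds (hu.pos_of_mem_ball hx))).differentiableAt
      (by norm_num)
  rw [(h1.pd j).self_of_nhds, pd_mul (a := fun y => deriv f (u y)) (hf'.comp x hd)
    (((hu.contDiffAt hx).pd (k := 1) (by norm_num) k).differentiableAt (by norm_num)),
    _root_.pd_comp hf'.hasDerivAt hd]

/-- The gradient estimate for `log u`. -/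
lemma IsPositiveClassicalSolution.gradSq_le (hu : IsPositiveClassicalSolution f u)
    (hf : ContDiffOn ℝ 2 f (Ioi 0)) (hn : 1 ≤ n) (hR : 0 < R) (hR1 : R ≤ 1) (hRR' : R < R')
    (hsub : ball x₀ R' ⊆ ball 0 1) {M : ℝ}
    (hM : ∀ x ∈ ball (0 : EuclideanSpace ℝ (Fin n)) 1,
      (deriv f (u x))⁺ + (f (u x))⁻ / u x ≤ M) :
    R ^ 4 * gradSq u x₀ ≤ 768 * n ^ 2 * (1 + M) * u x₀ ^ 2 := by
  have hK : ∀ x ∈ closedBall x₀ R, x ∈ ball (0 : EuclideanSpace ℝ (Fin n)) 1 := fun x hx =>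
    hsub (closedBall_subset_ball hRR' hx)
  have hM' : ∀ x ∈ ball (0 : EuclideanSpace ℝ (Fin n)) 1,
      0 ≤ M ∧ -f (u x) ≤ M * u x ∧ deriv f (u x) * u x - f (u x) ≤ M * u x := by
    intro x hx
    have h0 := hu.pos_of_mem_ball hx
    have h1 := hM x hx
    have h2 : 0 ≤ (deriv f (u x))⁺ := posPart_nonneg _
    have h3 : 0 ≤ (f (u x))⁻ / u x := div_nonneg (negPart_nonneg _) h0.le
    have h4 : deriv f (u x) ≤ (deriv f (u x))⁺ := le_posPart _
    have h5 : -f (u x) ≤ (f (u x))⁻ := neg_le_negPart _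
    have h6 : (f (u x))⁻ / u x * u x = (f (u x))⁻ := div_mul_cancel₀ _ h0.ne'
    refine ⟨by linarith, ?_, ?_⟩ <;> nlinarith
  have hM0 : 0 ≤ M := (hM' x₀ (hK x₀ (mem_closedBall_self hR.le))).1
  refine gradSq_le_of_isSmoothLimitSolution (G := fun y => f (u y)) hn hR hR1 (by linarith)
    (isSmoothLimitSolution_of_contDiffOn hR hRR' (hu.contDiffOn.mono hsub)
      (fun x hx => (hu.contDiffAt_comp hf (hsub hx)).contDiffWithinAt)
      fun x hx => hu.neg_lap (hsub hx))
    (fun x hx => (continuousAt_pairJet ((hu.contDiffAt (hK x hx)).of_le (by norm_num))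
      ((hu.contDiffAt_comp hf (hK x hx)).of_le (by norm_num))).continuousWithinAt)
    (fun x hx => hu.pos_of_mem_ball (hK x hx)) (fun x hx => ?_) (fun x hx => ?_)
  · have := (hM' x (hK x hx)).2.1
    have h0 := hu.pos_of_mem_ball (hK x hx)
    linarith
  · have h0 := hu.pos_of_mem_ball (hK x hx)
    have h1 : ∑ j, (pd j (fun y => f (u y)) x * u x - f (u x) * pd j u x) * pd j u x
        = (deriv f (u x) * u x - f (u x)) * gradSq u x := by
      rw [gradSq, Finset.mul_sum]
      refine Finset.sum_congr rfl fun j _ => ?_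
      rw [hu.pd_comp hf (hK x hx)]
      ring
    rw [h1]
    have h2 : (deriv f (u x) * u x - f (u x)) * gradSq u x ≤ ((1 + M) * u x) * gradSq u x :=
      mul_le_mul_of_nonneg_right (by linarith [(hM' x (hK x hx)).2.2]) (gradSq_nonneg _ _)
    have h3 : 0 ≤ (1 + M) ^ 2 * u x ^ 3 := by positivity
    linarith

/-- The gradient estimate for `log ∂ₖu`, given a bound for the gradient of `log u`. -/
lemma IsPositiveClassicalSolution.gradSq_pd_le (hu : IsPositiveClassicalSolution f u)
    (hf : ContDiffOn ℝ 2 f (Ioi 0)) (hn : 1 ≤ n) (hR : 0 < R) (hR1 : R ≤ 1) (hRR' : R < R')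
    (hsub : ball x₀ R' ⊆ ball 0 1) {k : Fin n}
    (hk : ∀ x ∈ ball (0 : EuclideanSpace ℝ (Fin n)) 1, 0 < pd k u x) {θ a b : ℝ}
    (hb : 0 ≤ b) (hθ : 1 ≤ θ) (hab : a * b ≤ θ ^ 3)
    (hf1 : ∀ x ∈ ball (0 : EuclideanSpace ℝ (Fin n)) 1, -θ ^ 2 ≤ deriv f (u x))
    (hf2 : ∀ x ∈ ball (0 : EuclideanSpace ℝ (Fin n)) 1, |u x * deriv (deriv f) (u x)| ≤ a)
    (hgrad : ∀ x ∈ closedBall x₀ R, gradSq u x ≤ (b * u x) ^ 2) :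
    R ^ 4 * gradSq (pd k u) x₀ ≤ 768 * n ^ 2 * θ ^ 2 * pd k u x₀ ^ 2 := by
  have hK : ∀ x ∈ closedBall x₀ R, x ∈ ball (0 : EuclideanSpace ℝ (Fin n)) 1 := fun x hx =>
    hsub (closedBall_subset_ball hRR' hx)
  refine gradSq_le_of_isSmoothLimitSolution (G := pd k fun y => f (u y)) hn hR hR1 (by nlinarith)
    (isSmoothLimitSolution_pd hR hRR' (hu.contDiffOn.mono hsub)
      (fun x hx => (hu.contDiffAt_comp hf (hsub hx)).contDiffWithinAt)
      (fun x hx => hu.neg_lap (hsub hx)) k)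
    (fun x hx => (continuousAt_pairJet ((hu.contDiffAt (hK x hx)).pd (by norm_num) k)
      ((hu.contDiffAt_comp hf (hK x hx)).pd (by norm_num) k)).continuousWithinAt)
    (fun x hx => hk x (hK x hx)) (fun x hx => ?_) (fun x hx => ?_)
  · rw [hu.pd_comp hf (hK x hx)]
    exact mul_le_mul_of_nonneg_right (hf1 x (hK x hx)) (hk x (hK x hx)).le
  · have hv := hk x (hK x hx)
    have hu0 := hu.pos_of_mem_ball (hK x hx)
    set v := pd k u with hvdef
    set B := √(gradSq v x) with hB
    have hB2 : B ^ 2 = gradSq v x := Real.sq_sqrt (gradSq_nonneg _ _)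
    have hB0 : 0 ≤ B := Real.sqrt_nonneg _
    -- The two terms containing `f'(u)` cancel, which leaves only `f''(u)`.
    have h1 : ∑ j, (pd j (pd k fun y => f (u y)) x * v x - pd k (fun y => f (u y)) x * pd j v x)
        * pd j v x = deriv (deriv f) (u x) * v x ^ 2 * ∑ j, pd j u x * pd j v x := by
      rw [Finset.mul_sum]
      refine Finset.sum_congr rfl fun j _ => ?_
      rw [hu.pd_comp hf (hK x hx), hu.pd_pd_comp hf (hK x hx)]
      ring
    have h2 : |∑ j, pd j u x * pd j v x| ≤ b * u x * B := by
      refine abs_le_of_sq_le_sq ?_ (by positivity)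
      calc (∑ j, pd j u x * pd j v x) ^ 2 ≤ gradSq u x * gradSq v x :=
            Finset.sum_mul_sq_le_sq_mul_sq _ _ _
        _ ≤ (b * u x) ^ 2 * B ^ 2 := by
            rw [hB2]
            exact mul_le_mul_of_nonneg_right (hgrad x hx) (gradSq_nonneg _ _)
        _ = (b * u x * B) ^ 2 := by ring
    have h3 : deriv (deriv f) (u x) * v x ^ 2 * ∑ j, pd j u x * pd j v x
        ≤ θ ^ 3 * (v x ^ 2 * B) := by
      calc deriv (deriv f) (u x) * v x ^ 2 * ∑ j, pd j u x * pd j v x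
          ≤ |deriv (deriv f) (u x) * v x ^ 2 * ∑ j, pd j u x * pd j v x| := le_abs_self _
        _ = |deriv (deriv f) (u x)| * v x ^ 2 * |∑ j, pd j u x * pd j v x| := by
            rw [abs_mul, abs_mul, abs_of_nonneg (sq_nonneg (v x))]
        _ ≤ |deriv (deriv f) (u x)| * v x ^ 2 * (b * u x * B) := by gcongr
        _ = |u x * deriv (deriv f) (u x)| * b * (v x ^ 2 * B) := by
            rw [abs_mul, abs_of_pos hu0]; ring
        _ ≤ a * b * (v x ^ 2 * B) := by
            gcongr
            exact hf2 x (hK x hx)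
        _ ≤ θ ^ 3 * (v x ^ 2 * B) := by gcongr
    rw [h1, ← hB2]
    refine h3.trans ?_
    have h4 : 0 ≤ θ ^ 2 * v x * (B ^ 2 - θ * v x * B + (θ * v x) ^ 2) := by
      have : 0 ≤ B ^ 2 - θ * v x * B + (θ * v x) ^ 2 := by
        nlinarith [sq_nonneg (B - θ * v x), sq_nonneg B, sq_nonneg (θ * v x)]
      positivity
    linarith

/-- The estimate with suprema replaced by arbitrary pointwise bounds. The roots that appear in the
final estimate are the numbers `s`, `m` and `φ` themselves. -/
theorem exists_norm_gradient_pd_div_le (hn : 1 ≤ n) {σ : ℝ} (hσ1 : σ < 1) :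
    ∃ C : ℝ, 0 < C ∧ ∀ (f : ℝ → ℝ) (u : EuclideanSpace ℝ (Fin n) → ℝ) (k : Fin n),
      ContDiffOn ℝ 2 f (Ioi 0) → IsPositiveClassicalSolution f u →
      (∀ x ∈ ball (0 : EuclideanSpace ℝ (Fin n)) 1, 0 < pd k u x) →
      ∀ s m φ : ℝ, 0 ≤ s → 0 ≤ m → 0 ≤ φ →
      (∀ x ∈ ball (0 : EuclideanSpace ℝ (Fin n)) 1, |u x * deriv (deriv f) (u x)| ≤ s ^ 3) →
      (∀ x ∈ ball (0 : EuclideanSpace ℝ (Fin n)) 1,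
        (deriv f (u x))⁺ + (f (u x))⁻ / u x ≤ m ^ 6) →
      (∀ x ∈ ball (0 : EuclideanSpace ℝ (Fin n)) 1, (deriv f (u x))⁻ ≤ φ ^ 2) →
      ∀ x ∈ ball (0 : EuclideanSpace ℝ (Fin n)) σ,
        ‖∇ (pd k u) x‖ / pd k u x ≤ C * (1 + s * (1 + m) + φ) := by
  rcases le_or_gt σ 0 with hσ0 | hσ0
  · refine ⟨1, one_pos, fun f u k _ _ _ s m φ _ _ _ _ _ _ x hx => ?_⟩
    rw [ball_eq_empty.2 hσ0] at hx
    exact hx.elim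
  set R := (1 - σ) / 4 with hRdef
  have hR : 0 < R := by linarith
  have hR1 : R ≤ 1 := by linarith
  -- `28² ≥ 768`, so that `c²` bounds the constant of the Bernstein estimates.
  set c : ℝ := 1 + 28 * n / R ^ 2 with hcdef
  have hc1 : 1 ≤ c := by
    have : 0 ≤ 28 * n / R ^ 2 := by positivity
    linarith
  have hc : 768 * n ^ 2 ≤ c ^ 2 * R ^ 4 := by
    have h1 : c * R ^ 2 = R ^ 2 + 28 * n := by rw [hcdef]; field_simp
    have h2 : 28 * (n : ℝ) ≤ c * R ^ 2 := by rw [h1]; nlinarith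
    calc 768 * (n : ℝ) ^ 2 ≤ (28 * n) ^ 2 := by nlinarith [sq_nonneg (n : ℝ)]
      _ ≤ (c * R ^ 2) ^ 2 := by gcongr
      _ = c ^ 2 * R ^ 4 := by ring
  have hdiv : ∀ {q t : ℝ}, 0 ≤ t → R ^ 4 * q ≤ 768 * n ^ 2 * t → q ≤ c ^ 2 * t := by
    intro q t ht h
    have h1 : R ^ 4 * q ≤ R ^ 4 * (c ^ 2 * t) := by
      calc R ^ 4 * q ≤ 768 * n ^ 2 * t := h
        _ ≤ c ^ 2 * R ^ 4 * t := by gcongr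
        _ = R ^ 4 * (c ^ 2 * t) := by ring
    exact le_of_mul_le_mul_left h1 (by positivity)
  refine ⟨c ^ 2, by positivity, fun f u k hf hu hk s m φ hs hm hφ h1 h2 h3 x₀ hx₀ => ?_⟩
  have hsub : ∀ y : EuclideanSpace ℝ (Fin n), ‖y‖ < σ + 2 * R → ball y (2 * R) ⊆ ball 0 1 := by
    intro y hy
    refine ball_subset_ball' ?_
    rw [dist_zero_right]
    linarith
  rw [mem_ball_zero_iff] at hx₀
  have hgrad : ∀ x ∈ closedBall x₀ R, gradSq u x ≤ (c * (1 + m) ^ 3 * u x) ^ 2 := by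
    intro x hx
    have hx' : ‖x‖ < σ + 2 * R := by
      have := norm_le_norm_add_norm_sub' x x₀
      rw [mem_closedBall, dist_eq_norm] at hx
      linarith
    have h4 := hu.gradSq_le hf hn hR hR1 (by linarith) (hsub x hx') h2
    have h5 : 1 + m ^ 6 ≤ (1 + m) ^ 6 := by
      have : 0 ≤ 6 * m + 15 * m ^ 2 + 20 * m ^ 3 + 15 * m ^ 4 + 6 * m ^ 5 := by positivity
      linarith [show (1 + m) ^ 6
        = 1 + m ^ 6 + (6 * m + 15 * m ^ 2 + 20 * m ^ 3 + 15 * m ^ 4 + 6 * m ^ 5) by ring]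
    calc gradSq u x ≤ c ^ 2 * ((1 + m ^ 6) * u x ^ 2) :=
          hdiv (by positivity) (h4.trans_eq (by ring))
      _ ≤ c ^ 2 * ((1 + m) ^ 6 * u x ^ 2) := by gcongr
      _ = (c * (1 + m) ^ 3 * u x) ^ 2 := by ring
  set θ := 1 + φ + c * (s * (1 + m)) with hθ
  have hsm : 0 ≤ s * (1 + m) := by positivity
  have hcsm : 0 ≤ c * (s * (1 + m)) := by positivity
  have hθ1 : 1 ≤ θ := by linarith
  have hx₀1 : x₀ ∈ ball (0 : EuclideanSpace ℝ (Fin n)) 1 := by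
    rw [mem_ball_zero_iff]; linarith
  have h6 := hu.gradSq_pd_le hf hn hR hR1 (by linarith) (hsub x₀ (by linarith)) hk (θ := θ)
    (a := s ^ 3) (b := c * (1 + m) ^ 3) (by positivity) hθ1 ?_ ?_ h1 hgrad
  · have h7 : gradSq (pd k u) x₀ ≤ c ^ 2 * (θ ^ 2 * pd k u x₀ ^ 2) :=
      hdiv (by positivity) (h6.trans_eq (by ring))
    have hv := hk x₀ hx₀1
    rw [div_le_iff₀ hv]
    have h8 : ‖∇ (pd k u) x₀‖ ≤ c * θ * pd k u x₀ := by
      refine le_of_sq_le_sq ?_ (by positivity)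
      rw [norm_gradient_sq]
      exact h7.trans_eq (by ring)
    refine h8.trans (mul_le_mul_of_nonneg_right ?_ hv.le)
    rw [sq, mul_assoc]
    refine mul_le_mul_of_nonneg_left ?_ (by positivity)
    nlinarith
  · calc s ^ 3 * (c * (1 + m) ^ 3) = c * (s * (1 + m)) ^ 3 := by ring
      _ ≤ c ^ 3 * (s * (1 + m)) ^ 3 := by
          gcongr
          exact le_self_pow₀ hc1 (by norm_num)
      _ = (c * (s * (1 + m))) ^ 3 := by ring
      _ ≤ θ ^ 3 := by gcongr; linarith
  · intro x hx
    have h4 := h3 x hx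
    have h5 : -deriv f (u x) ≤ (deriv f (u x))⁻ := neg_le_negPart _
    have h6 : φ ^ 2 ≤ θ ^ 2 := by gcongr; linarith
    linarith

lemma IsPositiveClassicalSolution.supBall_comp_ne_top (hu : IsPositiveClassicalSolution f u)
    {F : ℝ → ℝ} (hF : ContinuousOn F (Ioi 0)) : supBall 1 (fun x => F (u x)) ≠ ⊤ := by
  have hc : ContinuousOn (fun x => F (u x)) (closedBall 0 1) :=
    hF.comp hu.continuousOn fun x hx => hu.pos x hx
  obtain ⟨B, hB⟩ := ((isCompact_closedBall _ _).image_of_continuousOn hc).bddAbove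
  refine ne_top_of_le_ne_top (ENNReal.ofReal_ne_top (r := B)) (iSup₂_le fun x hx => ?_)
  exact ENNReal.ofReal_le_ofReal (hB ⟨x, ball_subset_closedBall hx, rfl⟩)

lemma le_toReal_supBall {R : ℝ} {g : EuclideanSpace ℝ (Fin n) → ℝ} (hg : supBall R g ≠ ⊤)
    {x : EuclideanSpace ℝ (Fin n)} (hx : x ∈ ball 0 R) : g x ≤ (supBall R g).toReal :=
  (ENNReal.ofReal_le_iff_le_toReal hg).1
    (le_iSup₂ (f := fun x (_ : x ∈ ball (0 : EuclideanSpace ℝ (Fin n)) R) => ENNReal.ofReal (g x))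
      x hx)

/-- A pointwise bound read off from the supremum of a root. -/
lemma le_toReal_supBall_pow {R : ℝ} {g : EuclideanSpace ℝ (Fin n) → ℝ} {q : ℝ} {d : ℕ}
    (hd : q * d = 1) (hg : supBall R (fun x => g x ^ q) ≠ ⊤)
    {x : EuclideanSpace ℝ (Fin n)} (hx : x ∈ ball 0 R) (h0 : 0 ≤ g x) :
    g x ≤ (supBall R fun x => g x ^ q).toReal ^ d := by
  calc g x = (g x ^ q) ^ d := by
        rw [← Real.rpow_natCast, ← Real.rpow_mul h0, hd, Real.rpow_one]
    _ ≤ _ := pow_le_pow_left₀ (Real.rpow_nonneg h0 _) (le_toReal_supBall hg hx) d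

end Solutions

/-! ### Passage to suprema, and pure powers -/

theorem theorem2p3 (n : ℕ) (hn : 1 ≤ n) (σ : ℝ) (hσ0 : 0 < σ) (hσ1 : σ < 1) :
    (∃ C₁ : ℝ≥0, 0 < C₁ ∧
      ∀ (f : ℝ → ℝ) (u : EuclideanSpace ℝ (Fin n) → ℝ),
        ContDiffOn ℝ 2 f (Ioi 0) →
        LocallyHolderOn (deriv (deriv f)) (Ioi 0) →
        IsPositiveClassicalSolution f u →
        (∀ x ∈ ball (0 : EuclideanSpace ℝ (Fin n)) 1, 0 < partialLast hn u x) →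
        supBall σ (fun x => ‖∇ (partialLast hn u) x‖ / partialLast hn u x) ≤
          C₁ * (1 +
            supBall 1 (fun x => |u x * deriv (deriv f) (u x)| ^ (1 / 3 : ℝ)) *
              (1 + supBall 1 (fun x => ((deriv f (u x))⁺ + (f (u x))⁻ / u x) ^ (1 / 6 : ℝ))) +
            supBall 1 (fun x => ((deriv f (u x))⁻) ^ (1 / 2 : ℝ)))) ∧
    (∀ p : ℝ, 1 < p → ∃ C₂ : ℝ≥0, 0 < C₂ ∧
      ∀ u : EuclideanSpace ℝ (Fin n) → ℝ,
        IsPositiveClassicalSolution (fun s => s ^ p) u →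
        (∀ x ∈ ball (0 : EuclideanSpace ℝ (Fin n)) 1, 0 < partialLast hn u x) →
        supBall σ (fun x => ‖∇ (partialLast hn u) x‖ / partialLast hn u x) ≤
          C₂ * (1 + supBall 1 u) ^ ((p - 1) / 2)) := by
  obtain ⟨C, hC, hmain⟩ := exists_norm_gradient_pd_div_le hn hσ1
  refine ⟨⟨C.toNNReal, Real.toNNReal_pos.2 hC, fun f u hf _ hu hv => ?_⟩,
    fun p hp => ⟨(C * (3 * p ^ 3)).toNNReal, Real.toNNReal_pos.2 (by positivity),
      fun u hu hv => ?_⟩⟩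
  · obtain ⟨hf1, hf2⟩ := hf.deriv_Ioi
    have hid : ContinuousOn (fun t : ℝ => t) (Ioi 0) := continuousOn_id
    have hS : supBall 1 (fun x => |u x * deriv (deriv f) (u x)| ^ (1 / 3 : ℝ)) ≠ ⊤ :=
      hu.supBall_comp_ne_top (F := fun t => |t * deriv (deriv f) t| ^ (1 / 3 : ℝ))
        ((hid.mul hf2).abs.rpow_const fun _ _ => Or.inr (by norm_num))
    have hM : supBall 1 (fun x => ((deriv f (u x))⁺ + (f (u x))⁻ / u x) ^ (1 / 6 : ℝ)) ≠ ⊤ :=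
      hu.supBall_comp_ne_top (F := fun t => ((deriv f t)⁺ + (f t)⁻ / t) ^ (1 / 6 : ℝ))
        ((((hf1.continuousOn.sup continuousOn_const).add
          ((hf.continuousOn.neg.sup continuousOn_const).div hid fun t ht => ht.ne')).rpow_const
            fun _ _ => Or.inr (by norm_num)))
    have hΦ : supBall 1 (fun x => ((deriv f (u x))⁻) ^ (1 / 2 : ℝ)) ≠ ⊤ :=
      hu.supBall_comp_ne_top (F := fun t => ((deriv f t)⁻) ^ (1 / 2 : ℝ))
        ((hf1.continuousOn.neg.sup continuousOn_const).rpow_const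
          fun _ _ => Or.inr (by norm_num))
    have key := hmain f u _ hf hu hv _ _ _ ENNReal.toReal_nonneg ENNReal.toReal_nonneg
      ENNReal.toReal_nonneg
      (fun x hx => le_toReal_supBall_pow (by norm_num) hS hx (abs_nonneg _))
      (fun x hx => le_toReal_supBall_pow (by norm_num) hM hx
        (add_nonneg (posPart_nonneg _)
          (div_nonneg (negPart_nonneg _) (hu.pos_of_mem_ball hx).le)))
      (fun x hx => le_toReal_supBall_pow (by norm_num) hΦ hx (negPart_nonneg _))
    refine iSup₂_le fun x hx => (ENNReal.ofReal_le_ofReal (key x hx)).trans (le_of_eq ?_)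
    generalize supBall 1 (fun x => |u x * deriv (deriv f) (u x)| ^ (1 / 3 : ℝ)) = S at *
    generalize supBall 1 (fun x => ((deriv f (u x))⁺ + (f (u x))⁻ / u x) ^ (1 / 6 : ℝ)) = M at *
    generalize supBall 1 (fun x => ((deriv f (u x))⁻) ^ (1 / 2 : ℝ)) = Φ at *
    rw [ENNReal.ofReal_mul hC.le, ENNReal.ofReal_add (by positivity) (by positivity),
      ENNReal.ofReal_add (by positivity) (by positivity), ENNReal.ofReal_mul (by positivity),
      ENNReal.ofReal_add (by positivity) (by positivity), ENNReal.ofReal_toReal hS,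
      ENNReal.ofReal_toReal hM, ENNReal.ofReal_toReal hΦ, ENNReal.ofReal_one]
    rfl
  · have hf : ContDiffOn ℝ 2 (fun t : ℝ => t ^ p) (Ioi 0) := fun t ht =>
      (Real.contDiffAt_rpow_const_of_ne ht.ne').contDiffWithinAt
    have hd1 : ∀ t : ℝ, 0 < t → deriv (fun t : ℝ => t ^ p) t = p * t ^ (p - 1) := fun t ht =>
      (Real.hasDerivAt_rpow_const (Or.inl ht.ne')).deriv
    have hd2 : ∀ t : ℝ, 0 < t →
        t * deriv (deriv fun t : ℝ => t ^ p) t = p * (p - 1) * t ^ (p - 1) := by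
      intro t ht
      have h1 : deriv (fun t : ℝ => t ^ p) =ᶠ[𝓝 t] fun t => p * t ^ (p - 1) := by
        filter_upwards [Ioi_mem_nhds ht] with r hr using hd1 r hr
      rw [h1.deriv_eq, ((Real.hasDerivAt_rpow_const (Or.inl ht.ne')).const_mul p).deriv]
      have h2 : t ^ (p - 1) = t ^ (p - 1 - 1) * t := by
        rw [← Real.rpow_add_one ht.ne', sub_add_cancel]
      rw [h2]
      ring
    have hT : supBall 1 u ≠ ⊤ := hu.supBall_comp_ne_top (F := fun t => t) continuousOn_id
    set T := (supBall 1 u).toReal with hTdef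
    have hT0 : 0 ≤ T := ENNReal.toReal_nonneg
    -- The natural scale: `X³` is the right-hand side and `X⁶` bounds `u ^ (p - 1)`.
    set X := (1 + T) ^ ((p - 1) / 6) with hX
    have hX1 : 1 ≤ X := Real.one_le_rpow (by linarith) (by linarith)
    have hX6 : ∀ x ∈ ball (0 : EuclideanSpace ℝ (Fin n)) 1, u x ^ (p - 1) ≤ X ^ 6 := by
      intro x hx
      have h1 : X ^ 6 = (1 + T) ^ (p - 1) := by
        rw [hX, ← Real.rpow_natCast, ← Real.rpow_mul (by positivity)]
        congr 1
        push_cast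
        ring
      rw [h1]
      exact Real.rpow_le_rpow (hu.pos_of_mem_ball hx).le
        (by linarith [le_toReal_supBall hT hx]) (by linarith)
    have hX3 : X ^ 3 = (1 + T) ^ ((p - 1) / 2) := by
      rw [hX, ← Real.rpow_natCast, ← Real.rpow_mul (by positivity)]
      congr 1
      push_cast
      ring
    have hp2 : p * (p - 1) ≤ p ^ 6 := by
      have : p ^ 2 ≤ p ^ 6 := pow_le_pow_right₀ hp.le (by norm_num)
      nlinarith
    have key := hmain _ u _ hf hu hv (p ^ 2 * X ^ 2) (p * X) 0 (by positivity) (by positivity)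
      le_rfl ?_ ?_ ?_
    · refine iSup₂_le fun x hx => (ENNReal.ofReal_le_ofReal ((key x hx).trans
        (?_ : _ ≤ C * (3 * p ^ 3) * X ^ 3))).trans (le_of_eq ?_)
      · rw [mul_assoc C]
        refine mul_le_mul_of_nonneg_left ?_ hC.le
        have h1 : 1 ≤ p * X := one_le_mul_of_one_le_of_one_le hp.le hX1
        have h2 : (p * X) ^ 2 ≤ (p * X) ^ 3 := pow_le_pow_right₀ h1 (by norm_num)
        have h3 : 1 ≤ (p * X) ^ 3 := one_le_pow₀ h1
        linarith [show p ^ 2 * X ^ 2 * (1 + p * X) = (p * X) ^ 2 + (p * X) ^ 3 by ring,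
          show 3 * p ^ 3 * X ^ 3 = 3 * (p * X) ^ 3 by ring]
      · rw [ENNReal.ofReal_mul (by positivity), hX3,
          ← ENNReal.ofReal_rpow_of_pos (by positivity), ENNReal.ofReal_add zero_le_one hT0,
          ENNReal.ofReal_one, ENNReal.ofReal_toReal hT]
        rfl
    · intro x hx
      have h0 := hu.pos_of_mem_ball hx
      have h1 : 0 ≤ p * (p - 1) := by nlinarith
      rw [hd2 _ h0, abs_of_nonneg (by positivity)]
      calc p * (p - 1) * u x ^ (p - 1) ≤ p ^ 6 * X ^ 6 := by
            gcongr
            exact hX6 x hx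
        _ = (p ^ 2 * X ^ 2) ^ 3 := by ring
    · intro x hx
      have h0 := hu.pos_of_mem_ball hx
      rw [hd1 _ h0, posPart_eq_self.2 (by positivity), negPart_eq_zero.2 (by positivity),
        zero_div, add_zero, mul_pow]
      gcongr
      · exact le_self_pow₀ hp.le (by norm_num)
      · exact hX6 x hx
    · intro x hx
      have h0 := hu.pos_of_mem_ball hx
      rw [hd1 _ h0, negPart_eq_zero.2 (by positivity)]
      norm_num
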